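/- Hypergraphs are finite and may have multiple edges. A hypergraph is $(d,r)$-regular if $r\ge 2$, every edge consists of exactly $r$ vertices and every vertex lies in exactly $d$ edges; its eigenvalues (with multiplicity) are those of the adjacency matrix whose $(u,v)$ entry is the number of edges containing both $u$ and $v$ if $u\ne v$, and $0$ if $u=v$. It is connected if it has a vertex and any two vertices are joined by a walk. A $2$-cover of a hypergraph $H$ is a hypergraph $\bar H$ with a surjective map $V(\bar H)\to V(H)$ and a map $E(\bar H)\to E(H)$ such that each edge of $\bar H$ is mapped bijectively onto its image edge, the edges of $\bar H$ containing a vertex $\bar v$ are mapped bijectively onto the edges of $H$ containing the image of $\bar v$, and every vertex and every edge of $H$ has exactly two preimages. **Theorem 1.3.** Let $d\ge 2$ and $r\ge 2$, and let $H$ be a connected $(d,r)$-regular hypergraph. Then $H$ has a right-sided Ramanujan $2$-covering: there is a $2$-cover $\bar H$ of $H$ such that the multiset of eigenvalues of $\bar H$ is the union, with multiplicities, of the multiset of eigenvalues of $H$ (the old eigenvalues) and a multiset of new eigenvalues, and every new eigenvalue $\lambda$ satisfies $$\lambda\le r-2+2\sqrt{(d-1)(r-1)}.$$ -/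

import Mathlib

universe u v

/-- A hypergraph with vertex set `V` and edges indexed by `E`; each edge is a finite set of
vertices. Multiple edges are allowed (`edge` need not be injective). -/
structure MHypergraph (V : Type*) (E : Type*) where
  /-- the set of vertices of an edge -/
  edge : E → Finset V

namespace MHypergraph

/-- The degree of a vertex: the number of edges containing it. -/
def degree {V E : Type*} [DecidableEq V] [Fintype E] (H : MHypergraph V E) (v : V) : ℕ :=
  (Finset.univ.filter fun e : E => v ∈ H.edge e).card

/-- `r`-uniform: `r ≥ 2` and every edge has exactly `r` vertices. -/
def IsUniform {V E : Type*} (H : MHypergraph V E) (r : ℕ) : Prop :=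
  2 ≤ r ∧ ∀ e, (H.edge e).card = r

/-- `(d, r)`-regular: every vertex has degree `d`, and the hypergraph is `r`-uniform. -/
def IsRegular {V E : Type*} [DecidableEq V] [Fintype E] (H : MHypergraph V E) (d r : ℕ) : Prop :=
  (∀ v, H.degree v = d) ∧ H.IsUniform r

/-- Two vertices are adjacent if they are distinct and lie in a common edge. -/
def Adj {V E : Type*} (H : MHypergraph V E) (u v : V) : Prop :=
  u ≠ v ∧ ∃ e, u ∈ H.edge e ∧ v ∈ H.edge e

/-- Connected: nonempty, and any two vertices are joined by a walk. -/
def Connected {V E : Type*} (H : MHypergraph V E) : Prop :=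
  Nonempty V ∧ ∀ u v, Relation.ReflTransGen H.Adj u v

/-- The adjacency matrix: the `(u, v)` entry is the number of edges containing both `u` and `v`
if `u ≠ v`, and `0` if `u = v`. -/
def adjMatrix {V E : Type*} [DecidableEq V] [Fintype E] (H : MHypergraph V E) : Matrix V V ℝ :=
  Matrix.of fun u v =>
    if u = v then 0 else ((Finset.univ.filter fun e : E => u ∈ H.edge e ∧ v ∈ H.edge e).card : ℝ)

/-- The eigenvalues of a hypergraph with their multiplicities: the multiset of roots of the
characteristic polynomial of the (real symmetric) adjacency matrix. -/
noncomputable def eigenvalues {V E : Type*} [Fintype V] [DecidableEq V] [Fintype E]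
    (H : MHypergraph V E) : Multiset ℝ :=
  H.adjMatrix.charpoly.roots

/-- A covering projection, given by its map `p` on vertices and the induced map `q` on edges. -/
structure IsCoveringProjection {V' E' V E : Type*} (H' : MHypergraph V' E') (H : MHypergraph V E)
    (p : V' → V) (q : E' → E) : Prop where
  /-- `p` is onto -/
  surjective : Function.Surjective p
  /-- `p` maps each edge bijectively onto its image edge -/
  bijOn_edge : ∀ e', Set.BijOn p {v' | v' ∈ H'.edge e'} {v | v ∈ H.edge (q e')}
  /-- `q` maps the edges at `v'` bijectively onto the edges at `p v'` -/
  bijOn_star : ∀ v', Set.BijOn q {e' | v' ∈ H'.edge e'} {e | p v' ∈ H.edge e}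

/-- `H'` is a `k`-cover of `H`: there is a covering projection under which every vertex and every
edge of `H` has exactly `k` preimages. -/
def IsCover {V' E' V E : Type*} (k : ℕ) (H' : MHypergraph V' E') (H : MHypergraph V E) : Prop :=
  ∃ (p : V' → V) (q : E' → E), H'.IsCoveringProjection H p q ∧
    (∀ v, Nat.card {v' // p v' = v} = k) ∧ (∀ e, Nat.card {e' // q e' = e} = k)

/-- The new eigenvalues of a cover `H'` of `H`: the eigenvalues of `H'` that are left, with
multiplicity, after the eigenvalues of `H` (the old ones) are removed. -/
noncomputable def newEigenvalues {V' E' V E : Type*} [Fintype V'] [DecidableEq V'] [Fintype E']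
    [Fintype V] [DecidableEq V] [Fintype E]
    (H' : MHypergraph V' E') (H : MHypergraph V E) : Multiset ℝ :=
  H'.eigenvalues - H.eigenvalues

/-- `H'` is a right-sided Ramanujan 2-covering of the `(d, r)`-regular hypergraph `H`: it is a
2-cover, its eigenvalues are the old ones together with the new ones, and every new eigenvalue is
at most `r - 2 + 2 √((d - 1)(r - 1))`. -/
def IsRightSidedRamanujanCover {V' E' V E : Type*} [Fintype V'] [DecidableEq V'] [Fintype E']
    [Fintype V] [DecidableEq V] [Fintype E]
    (H' : MHypergraph V' E') (H : MHypergraph V E) (d r : ℕ) : Prop :=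
  IsCover 2 H' H ∧
    H'.eigenvalues = H.eigenvalues + H'.newEigenvalues H ∧
    ∀ x ∈ H'.newEigenvalues H, x ≤ (r : ℝ) - 2 + 2 * Real.sqrt (((d : ℝ) - 1) * ((r : ℝ) - 1))

end MHypergraph

/-! Signs on the incidences of `H` define a 2-cover whose adjacency matrix has block form `[P N; N
P]`. Here `P + N` is the adjacency matrix of `H` and `P - N = B Bᵀ - d`, with `B` the signed
incidence matrix. The new eigenvalues are therefore those of `B Bᵀ - d`, and since `(√(d-1) +
√(r-1))² - d` is the required bound, it suffices to find signs for which no singular value of `B`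
exceeds `√(d-1) + √(r-1)`.

This is the method of Marcus, Spielman and Srivastava, with positivity of all principal minors in
place of interlacing. Averaging the principal minors of `diag z - A` over the sign of one edge `ab`
acts as `1 - ∂_a ∂_b`, which preserves real stability. Averaging over all signs gives matching
polynomials, which are positive at every `x > √(d-1) + √(r-1)` by a Heilmann–Lieb bound
(`signedFamily_zero_pos`).

The signs are then fixed one at a time (`exists_signs_pos`). For one of the two signs the full minor
stays positive at `x`. Minors avoiding an endpoint of the edge do not see the sign, and the Rayleigh
inequality carries positivity to all the others (`re_pos_of_univ`). Positivity of all minors at `x`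
persists to the right of `x` (`re_pos_of_le`), so the final matrix has no eigenvalue in `[x, ∞)`. -/

open scoped ComplexConjugate

/-! ### Real stable multiaffine polynomials. -/

/-- A family of multiaffine polynomials in the variables `z i`, indexed by the sets of variables that
occur, closed under partial derivatives (`F (S.erase i)` is the derivative of `F S` in `z i`), with
real coefficients, and without zeros in the product of open upper half planes. -/
structure IsStableFamily {W : Type*} [DecidableEq W] (F : Finset W → (W → ℂ) → ℂ) : Prop where
  affine : ∀ S, ∀ i ∈ S, ∀ z w,
    F S (Function.update z i w) = F S z + (w - z i) * F (S.erase i) z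
  indep : ∀ S, ∀ i ∉ S, ∀ z w, F S (Function.update z i w) = F S z
  conj_eq : ∀ S z, F S (fun i => conj (z i)) = conj (F S z)
  continuous : ∀ S, Continuous (F S)
  ne_zero : ∀ S z, (∀ i, 0 < (z i).im) → F S z ≠ 0

/-- The operator `1 - ∂_a ∂_b` on families of multiaffine polynomials. -/
def edgeOp {W : Type*} [DecidableEq W] (a b : W) (F : Finset W → (W → ℂ) → ℂ) :
    Finset W → (W → ℂ) → ℂ :=
  fun S z => F S z - if a ∈ S ∧ b ∈ S then F ((S.erase a).erase b) z else 0

/-- Differential operators with constant coefficients commute; this lets the signs be fixed in any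
order. -/
theorem edgeOp_comm {W : Type*} [DecidableEq W] (a b c d : W) (F : Finset W → (W → ℂ) → ℂ) :
    edgeOp a b (edgeOp c d F) = edgeOp c d (edgeOp a b F) := by
  have key : ∀ S : Finset W, (((S.erase a).erase b).erase c).erase d
      = (((S.erase c).erase d).erase a).erase b := by
    intro S; ext x; simp only [Finset.mem_erase]; tauto
  funext S z
  simp only [edgeOp, key]
  by_cases h1 : a ∈ S <;> by_cases h2 : b ∈ S <;> by_cases h3 : c ∈ S <;> by_cases h4 : d ∈ S <;>
    simp [h1, h2, h3, h4]
  by_cases hac : a = c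
  · subst hac; simp; ring
  by_cases had : a = d
  · subst had; simp; ring
  by_cases hbc : b = c
  · subst hbc; simp; ring
  by_cases hbd : b = d
  · subst hbd; simp; ring
  simp [hac, had, hbc, hbd, Ne.symm hac, Ne.symm had, Ne.symm hbc, Ne.symm hbd]
  ring

namespace IsStableFamily

variable {W : Type*} [DecidableEq W] {F : Finset W → (W → ℂ) → ℂ}

/-- As a function of the `i`-th variable, `F S` is affine with root `z i - F S z / F (S.erase i) z`,
and stability keeps this root out of the open upper half plane. -/
theorem im_le_im_div (hF : IsStableFamily F) {S : Finset W} {i : W} (hi : i ∈ S) {z : W → ℂ}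
    (hz : ∀ j, 0 < (z j).im) : (z i).im ≤ (F S z / F (S.erase i) z).im := by
  by_contra! hlt
  have hne := hF.ne_zero (S.erase i) z hz
  refine hF.ne_zero S (Function.update z i (z i - F S z / F (S.erase i) z)) ?_ ?_
  · intro j
    rcases eq_or_ne j i with rfl | hj
    · simpa using hlt
    · simpa [hj] using hz j
  · rw [hF.affine S i hi]
    field_simp
    ring

/-- Clearing the denominator in `im_le_im_div` leaves a closed condition, which extends to real
points by a limit. -/
theorem im_mul_conj_nonneg (hF : IsStableFamily F) {S : Finset W} {i : W} (hi : i ∈ S) {z : W → ℂ}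
    (hz : ∀ j, 0 ≤ (z j).im) : 0 ≤ (F S z * conj (F (S.erase i) z)).im := by
  have hpos : ∀ z : W → ℂ, (∀ j, 0 < (z j).im) → 0 ≤ (F S z * conj (F (S.erase i) z)).im := by
    intro z hz
    have hne := hF.ne_zero (S.erase i) z hz
    have h1 : F S z * conj (F (S.erase i) z)
        = (F S z / F (S.erase i) z) * (Complex.normSq (F (S.erase i) z) : ℝ) := by
      rw [← Complex.mul_conj]
      field_simp
    rw [h1, Complex.im_mul_ofReal]
    exact mul_nonneg ((hz i).le.trans (hF.im_le_im_div hi hz)) (Complex.normSq_nonneg _)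
  have hcont : Continuous fun ε : ℝ =>
      (F S (fun j => z j + ε * Complex.I) * conj (F (S.erase i) (fun j => z j + ε * Complex.I))).im := by
    have hline : Continuous fun (ε : ℝ) (j : W) => z j + ε * Complex.I := by fun_prop
    exact Complex.continuous_im.comp (((hF.continuous S).comp hline).mul
      (Complex.continuous_conj.comp ((hF.continuous _).comp hline)))
  have hlim := (hcont.tendsto 0).mono_left (nhdsWithin_le_nhds (s := Set.Ioi 0))
  simp only [Complex.ofReal_zero, zero_mul, add_zero] at hlim
  refine ge_of_tendsto hlim ?_
  filter_upwards [self_mem_nhdsWithin] with ε hε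
  refine hpos _ fun j => ?_
  have := hz j
  have : (0 : ℝ) < ε := hε
  simp
  linarith

theorem im_ofReal (hF : IsStableFamily F) (S : Finset W) (x : W → ℝ) :
    (F S (fun i => (x i : ℂ))).im = 0 := by
  have h := hF.conj_eq S (fun i => (x i : ℂ))
  simp only [Complex.conj_ofReal] at h
  exact Complex.conj_eq_iff_im.1 h.symm

/-- The Rayleigh inequality for real stable multiaffine polynomials. -/
theorem rayleigh (hF : IsStableFamily F) {S : Finset W} {i j : W} (hi : i ∈ S) (hj : j ∈ S)
    (hij : i ≠ j) (x : W → ℝ) :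
    (F S (fun k => (x k : ℂ))).re * (F ((S.erase i).erase j) (fun k => (x k : ℂ))).re
      ≤ (F (S.erase i) (fun k => (x k : ℂ))).re * (F (S.erase j) (fun k => (x k : ℂ))).re := by
  -- At the point `x + I eᵢ` the polynomials `F S` and `F (S.erase j)` expand as `F + I ∂ᵢF`, and
  -- the imaginary part is the difference of the two sides.
  have h := hF.im_mul_conj_nonneg hj
    (z := Function.update (fun k => (x k : ℂ)) i (x i + Complex.I)) (by
      intro k
      rcases eq_or_ne k i with rfl | hk
      · simp
      · simp [hk])
  rw [hF.affine S i hi, hF.affine (S.erase j) i (by simp [hi, hij]),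
    Finset.erase_right_comm (a := j)] at h
  have h1 := hF.im_ofReal S x
  have h2 := hF.im_ofReal (S.erase i) x
  have h3 := hF.im_ofReal (S.erase j) x
  have h4 := hF.im_ofReal ((S.erase i).erase j) x
  simp [h1, h2, h3, h4] at h
  linarith

/-- Sylvester's criterion for stable families. -/
theorem re_pos_of_univ [Fintype W] (hF : IsStableFamily F) (i : W) (x : W → ℝ)
    (hi : ∀ S, i ∉ S → 0 < (F S (fun k => (x k : ℂ))).re)
    (huniv : 0 < (F Finset.univ (fun k => (x k : ℂ))).re) (S : Finset W) :
    0 < (F S (fun k => (x k : ℂ))).re := by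
  suffices h : ∀ T : Finset W, 0 < (F Tᶜ (fun k => (x k : ℂ))).re by simpa using h Sᶜ
  intro T
  induction T using Finset.induction_on with
  | empty => simpa using huniv
  | insert j T hj ih =>
    by_cases hiT : i ∈ insert j T
    · exact hi _ (by simpa only [Finset.mem_compl, not_not] using hiT)
    have hij : i ≠ j := fun h => hiT (by simp [h])
    have hiT' : i ∉ T := fun h => hiT (by simp [h])
    -- In the Rayleigh inequality the left side is positive, and so is the factor on the right that
    -- avoids `i`; hence so is the remaining factor.
    have hR := hF.rayleigh (S := Tᶜ) (i := i) (j := j) (by simpa) (by simpa) hij x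
    have h1 := hi (Tᶜ.erase i) (by simp)
    have h2 := hi ((Tᶜ.erase i).erase j) (by simp)
    rw [Finset.compl_insert]
    exact pos_of_mul_pos_right ((mul_pos ih h2).trans_le hR) h1.le

/-- For stability: a zero would make `∂_a F / ∂_a ∂_b F` and its inverse `F / ∂_a F` both lie in the
upper half plane, but inversion exchanges the two half planes. -/
theorem edgeOp (hF : IsStableFamily F) {a b : W} (hab : a ≠ b) :
    IsStableFamily (edgeOp a b F) where
  affine S i hi z w := by
    simp only [_root_.edgeOp, hF.affine S i hi]
    by_cases h : a ∈ S ∧ b ∈ S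
    · rcases eq_or_ne i a with rfl | hia
      · rw [hF.indep _ i (by simp)]
        simp [h]
        ring
      rcases eq_or_ne i b with rfl | hib
      · rw [hF.indep _ i (by simp)]
        simp [h]
        ring
      rw [hF.affine _ i (by simp [hi, hia, hib])]
      have : (((S.erase a).erase b).erase i) = ((S.erase i).erase a).erase b := by
        ext x; simp only [Finset.mem_erase]; tauto
      simp [h, hia.symm, hib.symm, this]
      ring
    · have h' : ¬ (a ∈ S.erase i ∧ b ∈ S.erase i) := fun h' =>
        h ⟨Finset.mem_of_mem_erase h'.1, Finset.mem_of_mem_erase h'.2⟩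
      simp only [if_neg h, if_neg h']
      ring
  indep S i hi z w := by
    simp only [_root_.edgeOp]
    rw [hF.indep S i hi, hF.indep _ i (by simp [hi])]
  conj_eq S z := by
    simp only [_root_.edgeOp, hF.conj_eq]
    split_ifs <;> simp
  continuous S := by
    unfold _root_.edgeOp
    have h1 := hF.continuous S
    have h2 := hF.continuous ((S.erase a).erase b)
    split_ifs
    · exact h1.sub h2
    · exact h1.sub continuous_const
  ne_zero S z hz := by
    unfold _root_.edgeOp
    split_ifs with h
    · have hb := hF.im_le_im_div (S := S) h.1 hz
      have ha := hF.im_le_im_div (S := S.erase a) (i := b) (by simp [h, hab.symm]) hz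
      have hne := hF.ne_zero (S.erase a) z hz
      have hne2 := hF.ne_zero ((S.erase a).erase b) z hz
      set p := F S z
      set q := F (S.erase a) z
      set r := F ((S.erase a).erase b) z
      intro h0
      have hpr : p / q = (q / r)⁻¹ := by
        rw [inv_div, sub_eq_zero.1 h0]
      have h1 : 0 < (q / r).im := (hz b).trans_le ha
      have h2 : 0 < ((q / r)⁻¹).im := by rw [← hpr]; exact (hz a).trans_le hb
      rw [Complex.inv_im] at h2
      have h3 : -(q / r).im / Complex.normSq (q / r) ≤ 0 :=
        div_nonpos_of_nonpos_of_nonneg (by linarith) (Complex.normSq_nonneg _)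
      linarith
    · simpa using hF.ne_zero S z hz

/-- Positivity of all the derivatives at a point persists when the point is increased. -/
theorem re_pos_of_le [Fintype W] (hF : IsStableFamily F) {x y : ℝ} (hxy : x ≤ y)
    (hx : ∀ S, 0 < (F S (fun _ => (x : ℂ))).re) (S : Finset W) :
    0 < (F S (fun _ => (y : ℂ))).re := by
  suffices h : ∀ T S : Finset W, 0 < (F S (fun k => if k ∈ T then (y : ℂ) else x)).re by
    simpa using h Finset.univ S
  intro T
  induction T using Finset.induction_on with
  | empty => simpa using hx
  | insert j T hj ih =>
    intro S
    have hup : (fun k => if k ∈ insert j T then (y : ℂ) else x)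
        = Function.update (fun k => if k ∈ T then (y : ℂ) else x) j y := by
      funext k
      rcases eq_or_ne k j with rfl | hk
      · simp
      · simp [hk]
    rw [hup]
    by_cases hjS : j ∈ S
    · rw [hF.affine S j hjS]
      have h1 := ih S
      have h2 := ih (S.erase j)
      have h3 : ((y : ℂ) - x) = ((y - x : ℝ) : ℂ) := by simp
      simp only [if_neg hj, h3, Complex.add_re, Complex.re_ofReal_mul]
      have := mul_nonneg (sub_nonneg.2 hxy) h2.le
      linarith
    · rw [hF.indep S j hjS]
      exact ih S

end IsStableFamily

/-! ### Principal minors of symmetric matrices and averaging over a sign. -/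

/-- The matrix `diag z - A`, with the rows and columns outside `S` replaced by those of `1`. -/
def charMinor {W : Type*} [DecidableEq W] (A : Matrix W W ℝ) (S : Finset W) (z : W → ℂ) :
    Matrix W W ℂ :=
  Matrix.diagonal (fun i => if i ∈ S then z i else 1) -
    Matrix.of fun i j => if i ∈ S ∧ j ∈ S then (A i j : ℂ) else 0

/-- The family of principal minors of `diag z - A`. -/
def detFamily {W : Type*} [Fintype W] [DecidableEq W] (A : Matrix W W ℝ) (S : Finset W)
    (z : W → ℂ) : ℂ :=
  (charMinor A S z).det

namespace Matrix

variable {W R : Type*} [Fintype W] [DecidableEq W] [CommRing R]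

theorem det_updateCol_single_of_row_eq_single {N : Matrix W W R} {k : W}
    (h : N k = Pi.single k 1) : (N.updateCol k (Pi.single k 1)).det = N.det := by
  symm
  refine det_eq_of_forall_row_eq_smul_add_const (fun i => if i = k then 0 else N i k) k (by simp) ?_
  intro i j
  have hk : ∀ j, N k j = if j = k then 1 else 0 := fun j => by rw [h, Pi.single_apply]
  by_cases hi : i = k
  · subst hi
    by_cases hj : j = i <;> simp [hk, hj]
  · by_cases hj : j = k <;> simp [hk, hi, hj]

theorem det_updateRow_single_swap (M : Matrix W W R) {a b : W} (hab : a ≠ b) :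
    ((M.updateRow a (Pi.single b 1)).updateRow b (Pi.single a 1)).det =
      -((M.updateRow a (Pi.single a 1)).updateRow b (Pi.single b 1)).det := by
  have h := det_permute (Equiv.swap a b)
    ((M.updateRow a (Pi.single a 1)).updateRow b (Pi.single b 1))
  rw [Equiv.Perm.sign_swap hab] at h
  simp only [Units.val_neg, Units.val_one, Int.cast_neg, Int.cast_one, neg_mul, one_mul] at h
  rw [← h]
  congr 1
  ext i j
  rcases eq_or_ne i a with rfl | ha
  · simp [hab]
  rcases eq_or_ne i b with rfl | hb
  · simp [hab]
  simp [ha, hb, updateRow_apply, Equiv.swap_apply_of_ne_of_ne]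

/-- Multilinearity in rows `a` and `b`. The terms linear in `t` cancel on averaging over `t = ±1`;
the quadratic one gives `-∂_a ∂_b`. -/
theorem det_add_offDiag_pair (M : Matrix W W R) {a b : W} (hab : a ≠ b) (t : R) :
    (M + t • (single a b 1 + single b a 1)).det =
      M.det + t * (M.updateRow a (Pi.single b 1)).det + t * (M.updateRow b (Pi.single a 1)).det
        - t ^ 2 * ((M.updateRow a (Pi.single a 1)).updateRow b (Pi.single b 1)).det := by
  have h1 : M + t • (single a b 1 + single b a 1)
      = (M.updateRow a (M a + t • Pi.single b 1)).updateRow b (M b + t • Pi.single a 1) := by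
    ext i j
    rcases eq_or_ne i b with rfl | hb
    · simp [single_apply, hab, Pi.single_apply, eq_comm]
    rcases eq_or_ne i a with rfl | ha
    · simp [single_apply, hab, hab.symm, Pi.single_apply, eq_comm]
    simp [ha, hb, ha.symm, hb.symm, updateRow_apply]
  have h2 : ∀ x, (M.updateRow a x).updateRow b (M b) = M.updateRow a x := by
    intro x
    conv_rhs => rw [← updateRow_eq_self (M.updateRow a x) b]
    rw [updateRow_ne hab.symm]
  rw [h1, det_updateRow_add, det_updateRow_smul, h2, det_updateRow_add, det_updateRow_smul,
    updateRow_eq_self, updateRow_comm _ hab, det_updateRow_add, det_updateRow_smul,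
    updateRow_comm _ hab.symm (Pi.single a 1), updateRow_comm _ hab.symm (Pi.single a 1),
    det_updateRow_single_swap M hab]
  have h3 : (M.updateRow a (M a)).updateRow b (Pi.single a 1) = M.updateRow b (Pi.single a 1) := by
    rw [updateRow_eq_self]
  rw [h3]
  ring

end Matrix

open Matrix

section DetFamily

variable {W : Type*} [DecidableEq W]

theorem charMinor_congr {A B : Matrix W W ℝ} {S : Finset W} (h : ∀ i ∈ S, ∀ j ∈ S, A i j = B i j)
    (z : W → ℂ) : charMinor A S z = charMinor B S z := by
  unfold charMinor
  congr 2
  ext i j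
  split_ifs with hij
  · rw [h i hij.1 j hij.2]
  · rfl

theorem charMinor_update {A : Matrix W W ℝ} {S : Finset W} {i : W} (hi : i ∈ S) (z : W → ℂ) (w : ℂ) :
    charMinor A S (Function.update z i w) =
      (charMinor A S z).updateRow i (charMinor A S z i + (w - z i) • Pi.single i 1) := by
  ext k j
  rcases eq_or_ne k i with rfl | hk
  · rcases eq_or_ne j k with rfl | hj
    · simp [charMinor, hi]
    · simp [charMinor, hi, hj, hj.symm]
  · simp [charMinor, hk, diagonal_apply]

theorem charMinor_erase (A : Matrix W W ℝ) (S : Finset W) (i : W) (z : W → ℂ) :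
    charMinor A (S.erase i) z =
      ((charMinor A S z).updateRow i (Pi.single i 1)).updateCol i (Pi.single i 1) := by
  ext k j
  rcases eq_or_ne j i with rfl | hj
  · rcases eq_or_ne k j with rfl | hk
    · simp [charMinor]
    · simp [charMinor, hk]
  · rcases eq_or_ne k i with rfl | hk
    · simp [charMinor, hj, hj.symm]
    · simp [charMinor, hj, hk, diagonal_apply]

variable [Fintype W]

theorem detFamily_congr {A B : Matrix W W ℝ} {S : Finset W} (h : ∀ i ∈ S, ∀ j ∈ S, A i j = B i j) :
    detFamily A S = detFamily B S := by
  funext z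
  rw [detFamily, charMinor_congr h, detFamily]

theorem detFamily_empty (A : Matrix W W ℝ) (z : W → ℂ) : detFamily A ∅ z = 1 := by
  have : charMinor A ∅ z = 1 := by
    ext i j
    simp [charMinor, Matrix.one_apply]
  rw [detFamily, this, det_one]

theorem det_updateRow_charMinor (A : Matrix W W ℝ) (S : Finset W) (i : W) (z : W → ℂ) :
    ((charMinor A S z).updateRow i (Pi.single i 1)).det = detFamily A (S.erase i) z := by
  rw [detFamily, charMinor_erase, det_updateCol_single_of_row_eq_single (by simp)]

theorem det_updateRow_updateRow_charMinor (A : Matrix W W ℝ) (S : Finset W) {a b : W} (hab : a ≠ b)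
    (z : W → ℂ) :
    (((charMinor A S z).updateRow a (Pi.single a 1)).updateRow b (Pi.single b 1)).det =
      detFamily A ((S.erase a).erase b) z := by
  rw [← det_updateRow_charMinor, charMinor_erase,
    ← det_updateCol_single_of_row_eq_single (k := a)]
  · congr 1
    ext i j
    rcases eq_or_ne i b with rfl | hb
    · rcases eq_or_ne j a with rfl | ha
      · simp [hab.symm]
      · simp [ha]
    · simp [updateCol_apply, updateRow_apply, hb]
  · rw [updateRow_ne hab, updateRow_self]

/-- For a kernel vector `y`, the form `y* A y` is real, so `∑ Im(z i) |y i|²` over `S` vanishes;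
outside `S` the rows of the identity force `y i = 0`. -/
theorem detFamily_ne_zero {A : Matrix W W ℝ} (hA : A.IsSymm) (S : Finset W) {z : W → ℂ}
    (hz : ∀ i, 0 < (z i).im) : detFamily A S z ≠ 0 := by
  intro h0
  obtain ⟨y, hy0, hy⟩ := exists_mulVec_eq_zero_iff.2 h0
  have hrow : ∀ i, (if i ∈ S then z i else 1) * y i
      = ∑ j, (if i ∈ S ∧ j ∈ S then (A i j : ℂ) else 0) * y j := by
    intro i
    have h := congrFun hy i
    rw [charMinor, sub_mulVec, Pi.sub_apply, mulVec_diagonal, Pi.zero_apply, sub_eq_zero] at h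
    exact h
  have hout : ∀ i ∉ S, y i = 0 := by
    intro i hi
    simpa [hi] using hrow i
  set Q : ℂ := ∑ i, ∑ j, conj (y i) * ((if i ∈ S ∧ j ∈ S then (A i j : ℂ) else 0) * y j) with hQ
  have hQreal : conj Q = Q := by
    rw [hQ, map_sum]
    simp only [map_sum, map_mul, Complex.conj_conj]
    rw [Finset.sum_comm]
    refine Finset.sum_congr rfl fun i _ => Finset.sum_congr rfl fun j _ => ?_
    by_cases h : i ∈ S ∧ j ∈ S
    · rw [if_pos h, if_pos h.symm, Complex.conj_ofReal, hA.apply]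
      ring
    · rw [if_neg h, if_neg (fun h' => h h'.symm)]
      simp
  have hQim : Q.im = 0 := Complex.conj_eq_iff_im.1 hQreal
  have hQ2 : Q = ∑ i, (if i ∈ S then z i else 1) * (Complex.normSq (y i) : ℝ) := by
    rw [hQ]
    refine Finset.sum_congr rfl fun i _ => ?_
    rw [← Finset.mul_sum, ← hrow i, ← Complex.mul_conj]
    ring
  have hsum : ∑ i, (if i ∈ S then (z i).im else 0) * Complex.normSq (y i) = 0 := by
    refine Eq.trans ?_ hQim
    rw [hQ2, Complex.im_sum]
    refine Finset.sum_congr rfl fun i _ => ?_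
    rw [Complex.im_mul_ofReal]
    congr 1
    split_ifs <;> simp
  rw [Finset.sum_eq_zero_iff_of_nonneg] at hsum
  · refine hy0 (funext fun i => ?_)
    by_cases hi : i ∈ S
    · have := hsum i (Finset.mem_univ i)
      simpa [hi, (hz i).ne'] using this
    · exact hout i hi
  · intro i _
    refine mul_nonneg ?_ (Complex.normSq_nonneg _)
    split_ifs
    · exact (hz i).le
    · exact le_rfl

theorem isStableFamily_detFamily {A : Matrix W W ℝ} (hA : A.IsSymm) :
    IsStableFamily (detFamily A) where
  affine S i hi z w := by
    rw [detFamily, charMinor_update hi, det_updateRow_add, det_updateRow_smul, updateRow_eq_self,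
      det_updateRow_charMinor]
    rfl
  indep S i hi z w := by
    unfold detFamily charMinor
    congr 3
    funext k
    rcases eq_or_ne k i with rfl | hk
    · simp [hi]
    · simp [hk]
  conj_eq S z := by
    rw [detFamily, detFamily, RingHom.map_det]
    congr 1
    ext i j
    simp only [charMinor, RingHom.mapMatrix_apply, map_apply, Matrix.sub_apply, map_sub, of_apply,
      diagonal_apply]
    congr 1 <;> split_ifs <;> simp
  continuous S := by
    unfold detFamily
    refine Continuous.matrix_det ?_
    refine Continuous.sub (Continuous.matrix_diagonal ?_) continuous_const
    refine continuous_pi fun i => ?_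
    split_ifs
    · exact continuous_apply i
    · exact continuous_const
  ne_zero S z hz := detFamily_ne_zero hA S hz

/-- Averaging the characteristic minors over the two signs of an edge amounts to `1 - ∂_a ∂_b`. -/
theorem detFamily_add_detFamily_sub (A : Matrix W W ℝ) {a b : W} (hab : a ≠ b) (S : Finset W)
    (z : W → ℂ) :
    detFamily (A + (single a b 1 + single b a 1)) S z
      + detFamily (A - (single a b 1 + single b a 1)) S z = 2 * edgeOp a b (detFamily A) S z := by
  by_cases h : a ∈ S ∧ b ∈ S
  · have hpert : ∀ t : ℝ, charMinor (A + t • (single a b 1 + single b a 1)) S z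
        = charMinor A S z + (-t : ℂ) • (single a b 1 + single b a 1) := by
      intro t
      ext i j
      simp only [charMinor, Matrix.sub_apply, of_apply, Matrix.add_apply,
        Matrix.smul_apply, single_apply, smul_eq_mul]
      by_cases hij : i ∈ S ∧ j ∈ S
      · simp only [if_pos hij]
        split_ifs <;> push_cast <;> ring
      · have h1 : ¬ (a = i ∧ b = j) := fun h' => hij ⟨h'.1 ▸ h.1, h'.2 ▸ h.2⟩
        have h2 : ¬ (b = i ∧ a = j) := fun h' => hij ⟨h'.1 ▸ h.2, h'.2 ▸ h.1⟩
        simp [hij, h1, h2]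
    have h1 := hpert 1
    have h2 := hpert (-1)
    rw [one_smul] at h1
    rw [neg_one_smul, ← sub_eq_add_neg] at h2
    simp only [edgeOp, if_pos h]
    unfold detFamily
    rw [h1, h2, det_add_offDiag_pair _ hab, det_add_offDiag_pair _ hab,
      det_updateRow_updateRow_charMinor A S hab, detFamily]
    push_cast
    ring
  · have hne : ∀ i ∈ S, ∀ j ∈ S, (single a b (1 : ℝ) + single b a 1 : Matrix W W ℝ) i j = 0 := by
      intro i hi j hj
      have h1 : ¬ (a = i ∧ b = j) := fun h' => h ⟨h'.1 ▸ hi, h'.2 ▸ hj⟩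
      have h2 : ¬ (b = i ∧ a = j) := fun h' => h ⟨h'.2 ▸ hj, h'.1 ▸ hi⟩
      simp [h1, h2]
    rw [detFamily_congr (B := A) (by intro i hi j hj; rw [Matrix.add_apply, hne i hi j hj, add_zero]),
      detFamily_congr (B := A) (A := A - _)
        (by intro i hi j hj; rw [Matrix.sub_apply, hne i hi j hj, sub_zero])]
    simp only [edgeOp, if_neg h]
    ring

end DetFamily

/-! ### Matching polynomials and the Heilmann–Lieb bound. -/

/-- A family satisfies the recursion of the matching polynomials of the subgraphs induced by a
multigraph with edge multiplicities `N`. -/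
def IsMatchingFamily {W : Type*} [DecidableEq W] (N : W → W → ℕ)
    (F : Finset W → (W → ℂ) → ℂ) : Prop :=
  ∀ S, ∀ u ∈ S, ∀ z, F S z =
    z u * F (S.erase u) z - ∑ w ∈ S, (N u w : ℂ) * F ((S.erase u).erase w) z

theorem edgeOp_swap {W : Type*} [DecidableEq W] (a b : W) (F : Finset W → (W → ℂ) → ℂ) :
    edgeOp a b F = edgeOp b a F := by
  funext S z
  simp only [edgeOp, and_comm (a := a ∈ S), Finset.erase_right_comm (a := a)]

theorem edgeOp_of_notMem {W : Type*} [DecidableEq W] {a b : W} (F : Finset W → (W → ℂ) → ℂ)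
    {S : Finset W} (h : ¬ (a ∈ S ∧ b ∈ S)) : edgeOp a b F S = F S := by
  funext z
  simp [edgeOp, h]

namespace IsMatchingFamily

variable {W : Type*} [DecidableEq W] {N : W → W → ℕ} {F : Finset W → (W → ℂ) → ℂ}

/-- Minors without `a` are unchanged by the operator, so the subtracted `∂_a ∂_b` term is exactly
the term of a new edge `ab` in the recursion at `a`. -/
theorem edgeOp_left (hF : IsMatchingFamily N F) (a b : W) (S : Finset W) (ha : a ∈ S)
    (z : W → ℂ) : edgeOp a b F S z = z a * edgeOp a b F (S.erase a) z -
      ∑ w ∈ S, ((N a w + if w = b then 1 else 0 : ℕ) : ℂ) *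
        edgeOp a b F ((S.erase a).erase w) z := by
  rw [edgeOp_of_notMem (S := S.erase a) F (by simp)]
  have h1 : ∀ w, edgeOp a b F ((S.erase a).erase w) = F ((S.erase a).erase w) := fun w =>
    edgeOp_of_notMem F (by simp)
  simp only [h1, Nat.cast_add, add_mul, Finset.sum_add_distrib]
  rw [edgeOp, hF S a ha z]
  by_cases hb : b ∈ S <;> simp [ha, hb]
  ring

/-- The recursions at `u` for `S` and for `S` without `a` and `b` are subtracted; the terms `w = a`
and `w = b` occur only in the first. -/
theorem edgeOp_of_ne (hF : IsMatchingFamily N F) (a b : W) (S : Finset W) {u : W}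
    (hu : u ∈ S) (hua : u ≠ a) (hub : u ≠ b) (z : W → ℂ) :
    edgeOp a b F S z = z u * edgeOp a b F (S.erase u) z -
      ∑ w ∈ S, (N u w : ℂ) * edgeOp a b F ((S.erase u).erase w) z := by
  by_cases h : a ∈ S ∧ b ∈ S
  · have hcomm : ∀ w, ((((S.erase u).erase w).erase a).erase b)
        = ((((S.erase a).erase b).erase u).erase w) := by
      intro w; ext x; simp only [Finset.mem_erase]; tauto
    have hcomm' : (((S.erase u).erase a).erase b) = (((S.erase a).erase b).erase u) := by
      ext x; simp only [Finset.mem_erase]; tauto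
    have hsum : ∑ w ∈ S, (N u w : ℂ) * edgeOp a b F ((S.erase u).erase w) z
        = ∑ w ∈ S, (N u w : ℂ) * F ((S.erase u).erase w) z
          - ∑ w ∈ (S.erase a).erase b,
            (N u w : ℂ) * F ((((S.erase a).erase b).erase u).erase w) z := by
      have hfilter : (S.erase a).erase b = S.filter fun w => w ≠ b ∧ w ≠ a := by
        ext x; simp only [Finset.mem_erase, Finset.mem_filter]; tauto
      have hsub : ∑ w ∈ (S.erase a).erase b,
            (N u w : ℂ) * F ((((S.erase a).erase b).erase u).erase w) z
          = ∑ w ∈ S, if w ≠ b ∧ w ≠ a then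
            (N u w : ℂ) * F ((((S.erase a).erase b).erase u).erase w) z else 0 := by
        rw [← Finset.sum_filter, ← hfilter]
      rw [hsub, ← Finset.sum_sub_distrib]
      refine Finset.sum_congr rfl fun w hw => ?_
      simp only [edgeOp, hcomm, Finset.mem_erase, h.1, h.2, and_true, hua.symm, hub.symm, ne_eq,
        not_false_eq_true]
      rcases eq_or_ne w a with h1 | h1
      · simp [h1]
      rcases eq_or_ne w b with h2 | h2
      · simp [h2]
      simp [h1, h2, h1.symm, h2.symm, mul_sub]
    rw [hsum, edgeOp, edgeOp, if_pos h, if_pos (by simp [h, hua.symm, hub.symm]), hcomm', hF S u hu,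
      hF ((S.erase a).erase b) u (by simp [hu, hua, hub])]
    ring
  · rw [edgeOp_of_notMem F h, edgeOp_of_notMem (S := S.erase u) F
      (fun h' => h ⟨Finset.mem_of_mem_erase h'.1, Finset.mem_of_mem_erase h'.2⟩), hF S u hu]
    congr 1
    refine Finset.sum_congr rfl fun w _ => ?_
    rw [edgeOp_of_notMem (S := (S.erase u).erase w) F
      (fun h' => h ⟨Finset.mem_of_mem_erase (Finset.mem_of_mem_erase h'.1),
        Finset.mem_of_mem_erase (Finset.mem_of_mem_erase h'.2)⟩)]

/-- The operator `1 - ∂_a ∂_b` adds an edge `ab`. -/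
theorem edgeOp (hF : IsMatchingFamily N F) {a b : W} (hab : a ≠ b) :
    IsMatchingFamily
      (fun u w => N u w + if (u = a ∧ w = b) ∨ (u = b ∧ w = a) then 1 else 0) (edgeOp a b F) := by
  intro S u hu z
  rcases eq_or_ne u a with rfl | hua
  · simpa [hab] using hF.edgeOp_left u b S hu z
  rcases eq_or_ne u b with rfl | hub
  · rw [edgeOp_swap]
    simpa [hua] using hF.edgeOp_left u a S hu z
  · simpa [hua, hub] using hF.edgeOp_of_ne a b S hu hua hub z

theorem detFamily_zero [Fintype W] :
    IsMatchingFamily (fun _ _ => 0) (detFamily (0 : Matrix W W ℝ)) := by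
  have h : ∀ (S : Finset W) z, detFamily 0 S z = ∏ i ∈ S, z i := by
    intro S z
    have : charMinor (0 : Matrix W W ℝ) S z = diagonal (fun i => if i ∈ S then z i else 1) := by
      ext i j
      simp [charMinor]
    rw [detFamily, this, det_diagonal, Finset.prod_ite_mem, Finset.univ_inter]
  intro S u hu z
  simp [h, Finset.mul_prod_erase S z hu]

end IsMatchingFamily

/-- A bound of Heilmann–Lieb type for the roots of matching polynomials. -/
theorem matching_recursion_pos {W : Type*} [DecidableEq W] [Fintype W] {N : W → W → ℕ}
    (hsymm : ∀ u w, N u w = N w u) (hdiag : ∀ u, N u u = 0) {m : Finset W → ℝ} {x : ℝ}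
    (hempty : 0 < m ∅)
    (hrec : ∀ S, ∀ u ∈ S, m S = x * m (S.erase u) - ∑ w ∈ S, N u w * m ((S.erase u).erase w))
    {c g : W → ℝ} (hg : ∀ u, 0 < g u) (hgc : ∀ u w, N u w ≠ 0 → g u ≤ c w)
    (h1 : ∀ u, (∑ w, N u w : ℕ) - 1 ≤ (x - c u) * g u) (h2 : ∀ u, (∑ w, N u w : ℕ) < x * g u)
    (S : Finset W) : 0 < m S := by
  -- The ratio bound `c u ≤ m S / m (S.erase u)` is claimed only where `u` has lost an edge. In the
  -- recursion at `u` each neighbour `w` has lost its edge to `u`, so the induction never needs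
  -- more.
  suffices h : ∀ n, ∀ S : Finset W, S.card = n →
      0 < m S ∧ ∀ u ∈ S, ∑ w ∈ S, N u w + 1 ≤ ∑ w, N u w → c u * m (S.erase u) ≤ m S from
    (h _ S rfl).1
  intro n
  induction n with
  | zero =>
    intro S hS
    obtain rfl := Finset.card_eq_zero.1 hS
    simpa using hempty
  | succ n ih =>
    intro S hS
    have key : ∀ u ∈ S, 0 < m (S.erase u) ∧
        (x * g u - (∑ w ∈ S, N u w : ℕ)) * m (S.erase u) ≤ g u * m S := by
      intro u hu
      obtain ⟨hpos, hle⟩ := ih (S.erase u) (by rw [Finset.card_erase_of_mem hu, hS]; rfl)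
      refine ⟨hpos, ?_⟩
      have hsum : ∑ w ∈ S, N u w * (g u * m ((S.erase u).erase w))
          ≤ ∑ w ∈ S, (N u w : ℝ) * m (S.erase u) := by
        refine Finset.sum_le_sum fun w hw => ?_
        rcases Nat.eq_zero_or_pos (N u w) with h0 | h0
        · simp [h0]
        have hwu : w ≠ u := by
          rintro rfl
          simp [hdiag] at h0
        have hwS : w ∈ S.erase u := by simp [hw, hwu]
        have hdeg : ∑ w' ∈ S.erase u, N w w' + 1 ≤ ∑ w', N w w' := by
          have := Finset.sum_le_univ_sum_of_nonneg (f := N w) (s := S) (fun _ => Nat.zero_le _)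
          rw [← Finset.sum_erase_add _ _ hu, hsymm w u] at this
          omega
        have h3 := hle w hwS hdeg
        have hpos' := (ih (S.erase u) (by rw [Finset.card_erase_of_mem hu, hS]; rfl)).1
        refine mul_le_mul_of_nonneg_left ?_ (Nat.cast_nonneg _)
        -- The induction hypothesis covers only sets of size `n`, so the sign of this smaller value
        -- is not at hand; a negative value makes the bound trivial.
        rcases le_or_gt 0 (m ((S.erase u).erase w)) with h4 | h4
        · exact (mul_le_mul_of_nonneg_right (hgc u w h0.ne') h4).trans h3
        · exact (mul_nonpos_of_nonneg_of_nonpos (hg u).le h4.le).trans hpos.le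
      rw [hrec S u hu, mul_sub, Finset.mul_sum]
      rw [← Finset.sum_mul] at hsum
      have hsum' : ∑ w ∈ S, g u * (N u w * m ((S.erase u).erase w))
          = ∑ w ∈ S, N u w * (g u * m ((S.erase u).erase w)) :=
        Finset.sum_congr rfl fun w _ => by ring
      rw [hsum']
      push_cast
      linarith
    have hdegle : ∀ u, ((∑ w ∈ S, N u w : ℕ) : ℝ) ≤ (∑ w, N u w : ℕ) := fun u =>
      Nat.cast_le.2 (Finset.sum_le_univ_sum_of_nonneg fun _ => Nat.zero_le _)
    constructor
    · obtain ⟨u, hu⟩ := Finset.card_pos.1 (by omega : 0 < S.card)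
      obtain ⟨hpos, hle⟩ := key u hu
      refine pos_of_mul_pos_right (lt_of_lt_of_le (mul_pos ?_ hpos) hle) (hg u).le
      linarith [hdegle u, h2 u]
    · intro u hu hdeg
      obtain ⟨hpos, hle⟩ := key u hu
      have hdeg' : ((∑ w ∈ S, N u w : ℕ) : ℝ) + 1 ≤ (∑ w, N u w : ℕ) := by exact_mod_cast hdeg
      have h3 : c u * g u ≤ x * g u - (∑ w ∈ S, N u w : ℕ) := by linarith [h1 u]
      refine le_of_mul_le_mul_left ?_ (hg u)
      calc g u * (c u * m (S.erase u)) = c u * g u * m (S.erase u) := by ring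
        _ ≤ _ := mul_le_mul_of_nonneg_right h3 hpos.le
        _ ≤ _ := hle

/-! ### Signings of a bipartite graph and the choice of signs. -/

section SignedFamily

variable {V E : Type*} [DecidableEq V] [DecidableEq E]

/-- The symmetric block matrix with off-diagonal blocks `B` and `Bᵀ`. -/
def bipartiteMatrix {V E : Type*} (B : Matrix V E ℝ) : Matrix (V ⊕ E) (V ⊕ E) ℝ :=
  fromBlocks 0 B Bᵀ 0

theorem isSymm_bipartiteMatrix {V E : Type*} (B : Matrix V E ℝ) : (bipartiteMatrix B).IsSymm := by
  rw [bipartiteMatrix, IsSymm, fromBlocks_transpose]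
  simp

theorem bipartiteMatrix_zero {V E : Type*} : bipartiteMatrix (0 : Matrix V E ℝ) = 0 := by
  simp [bipartiteMatrix]

theorem bipartiteMatrix_add_single (B : Matrix V E ℝ) (i : V) (e : E) :
    bipartiteMatrix (B + single i e 1) = bipartiteMatrix B +
      (single (Sum.inl i) (Sum.inr e) 1 + single (Sum.inr e) (Sum.inl i) 1) := by
  ext (j | j) (k | k) <;> simp [bipartiteMatrix, single_apply, and_comm]

theorem bipartiteMatrix_sub_single (B : Matrix V E ℝ) (i : V) (e : E) :
    bipartiteMatrix (B - single i e 1) = bipartiteMatrix B -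
      (single (Sum.inl i) (Sum.inr e) 1 + single (Sum.inr e) (Sum.inl i) 1) := by
  rw [eq_sub_iff_add_eq, ← bipartiteMatrix_add_single, sub_add_cancel]

variable [Fintype V] [Fintype E]

/-- The average, over independent uniform signs added to the entries of `B` listed in `L`, of the
characteristic minors of `bipartiteMatrix B`. -/
def signedFamily (B : Matrix V E ℝ) (L : List (V × E)) : Finset (V ⊕ E) → (V ⊕ E → ℂ) → ℂ :=
  L.foldr (fun p F => edgeOp (Sum.inl p.1) (Sum.inr p.2) F) (detFamily (bipartiteMatrix B))

theorem signedFamily_cons (B : Matrix V E ℝ) (p : V × E) (L : List (V × E)) :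
    signedFamily B (p :: L) = edgeOp (Sum.inl p.1) (Sum.inr p.2) (signedFamily B L) := rfl

theorem isStableFamily_signedFamily (B : Matrix V E ℝ) (L : List (V × E)) :
    IsStableFamily (signedFamily B L) := by
  induction L with
  | nil => exact isStableFamily_detFamily (isSymm_bipartiteMatrix B)
  | cons p L ih => exact ih.edgeOp Sum.inl_ne_inr

theorem signedFamily_congr {B B' : Matrix V E ℝ} (L : List (V × E)) {S : Finset (V ⊕ E)}
    (h : ∀ i e, Sum.inl i ∈ S → Sum.inr e ∈ S → B i e = B' i e) :
    signedFamily B L S = signedFamily B' L S := by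
  induction L generalizing S with
  | nil =>
    refine detFamily_congr ?_
    rintro (i | i) hi (j | j) hj <;> simp [bipartiteMatrix]
    · exact h i j hi hj
    · exact h j i hj hi
  | cons p L ih =>
    funext z
    simp only [signedFamily_cons, edgeOp, ih h]
    rw [ih fun i e hi he => h i e (Finset.mem_of_mem_erase (Finset.mem_of_mem_erase hi))
      (Finset.mem_of_mem_erase (Finset.mem_of_mem_erase he))]

/-- One-edge averaging, moved past the operators of the remaining edges by commutation; this
justifies reading `signedFamily` as an average. -/
theorem signedFamily_add_signedFamily_sub (B : Matrix V E ℝ) (p : V × E) (L : List (V × E))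
    (S : Finset (V ⊕ E)) (z : V ⊕ E → ℂ) :
    signedFamily (B + single p.1 p.2 1) L S z + signedFamily (B - single p.1 p.2 1) L S z
      = 2 * signedFamily B (p :: L) S z := by
  induction L generalizing S with
  | nil =>
    have := detFamily_add_detFamily_sub (bipartiteMatrix B)
      (Sum.inl_ne_inr (a := p.1) (b := p.2)) S z
    rwa [← bipartiteMatrix_add_single, ← bipartiteMatrix_sub_single] at this
  | cons q L ih =>
    rw [signedFamily_cons, signedFamily_cons, signedFamily_cons, signedFamily_cons, edgeOp_comm,
      ← signedFamily_cons B p]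
    have h1 := ih S
    have h2 := ih ((S.erase (Sum.inl q.1)).erase (Sum.inr q.2))
    simp only [edgeOp]
    split_ifs
    · linear_combination h1 - h2
    · linear_combination h1

/-- The choice of signs: if all the averaged minors are positive at `x`, then so are the minors for
some choice of signs. -/
theorem exists_signs_pos (L : List (V × E)) (hL : L.Nodup) (B : Matrix V E ℝ) (x : ℝ)
    (h : ∀ S, 0 < (signedFamily B L S (fun _ => (x : ℂ))).re) :
    ∃ B' : Matrix V E ℝ, (∀ i e, (i, e) ∉ L → B' i e = B i e) ∧
      (∀ i e, (i, e) ∈ L → B' i e = B i e + 1 ∨ B' i e = B i e - 1) ∧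
      ∀ S, 0 < (detFamily (bipartiteMatrix B') S (fun _ => (x : ℂ))).re := by
  induction L generalizing B with
  | nil => exact ⟨B, by simp, by simp, h⟩
  | cons p L ih =>
    obtain ⟨i₀, e₀⟩ := p
    obtain ⟨hp, hL⟩ := List.nodup_cons.1 hL
    -- Without the row of `i₀` a minor does not involve the new entry, so it equals its average for
    -- either sign.
    have hoff : ∀ s : ℝ, ∀ S : Finset (V ⊕ E), Sum.inl i₀ ∉ S →
        0 < (signedFamily (B + s • single i₀ e₀ 1) L S (fun _ => (x : ℂ))).re := by
      intro s S hS
      have h1 := h S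
      rw [signedFamily_cons, edgeOp_of_notMem _ fun h' => hS h'.1] at h1
      rwa [signedFamily_congr (B' := B)]
      intro i e hi _
      have : i₀ ≠ i := fun h' => hS (h' ▸ hi)
      simp [this]
    have huniv : ∃ s : ℝ, (s = 1 ∨ s = -1) ∧
        0 < (signedFamily (B + s • single i₀ e₀ 1) L Finset.univ (fun _ => (x : ℂ))).re := by
      have h1 := congrArg Complex.re
        (signedFamily_add_signedFamily_sub B (i₀, e₀) L Finset.univ (fun _ => (x : ℂ)))
      have h2 := h Finset.univ
      rw [Complex.add_re, Complex.mul_re] at h1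
      simp only [Complex.re_ofNat, Complex.im_ofNat, zero_mul, sub_zero] at h1
      by_contra! hcon
      have h3 := hcon 1 (Or.inl rfl)
      have h4 := hcon (-1) (Or.inr rfl)
      rw [one_smul] at h3
      rw [neg_one_smul, ← sub_eq_add_neg] at h4
      linarith
    obtain ⟨s, hs, hpos⟩ := huniv
    obtain ⟨B', h1, h2, h3⟩ := ih hL (B + s • single i₀ e₀ 1)
      ((isStableFamily_signedFamily _ L).re_pos_of_univ (Sum.inl i₀) (fun _ => x) (hoff s) hpos)
    have hne : ∀ i e, (i, e) ≠ (i₀, e₀) → (B + s • single i₀ e₀ 1 : Matrix V E ℝ) i e = B i e := by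
      intro i e hie
      have : ¬ (i₀ = i ∧ e₀ = e) := fun h' => hie (by rw [h'.1, h'.2])
      simp [this]
    refine ⟨B', ?_, ?_, h3⟩
    · intro i e hie
      rw [List.mem_cons, not_or] at hie
      rw [h1 i e hie.2, hne i e hie.1]
    · intro i e hie
      rcases List.mem_cons.1 hie with hie | hie
      · obtain ⟨rfl, rfl⟩ := Prod.mk.injEq .. ▸ hie
        rw [h1 i e hp]
        rcases hs with rfl | rfl <;> simp [sub_eq_add_neg]
      · rw [← hne i e fun h' => hp (h' ▸ hie)]
        exact h2 i e hie

/-- The multiplicity of an edge in the bipartite multigraph with the given list of edges. -/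
def edgeMultiplicity (L : List (V × E)) : V ⊕ E → V ⊕ E → ℕ
  | Sum.inl i, Sum.inr e => L.count (i, e)
  | Sum.inr e, Sum.inl i => L.count (i, e)
  | _, _ => 0

theorem isMatchingFamily_signedFamily_zero (L : List (V × E)) :
    IsMatchingFamily (edgeMultiplicity L) (signedFamily 0 L) := by
  induction L with
  | nil =>
    have h : edgeMultiplicity ([] : List (V × E)) = fun _ _ => 0 := by
      funext a b
      rcases a with a | a <;> rcases b with b | b <;> simp [edgeMultiplicity]
    rw [h, signedFamily, bipartiteMatrix_zero]
    exact IsMatchingFamily.detFamily_zero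
  | cons p L ih =>
    have h := ih.edgeOp (Sum.inl_ne_inr (a := p.1) (b := p.2))
    rw [signedFamily_cons]
    convert h using 1
    funext a b
    obtain ⟨i, e⟩ := p
    rcases a with a | a <;> rcases b with b | b <;>
      simp [edgeMultiplicity, List.count_cons] <;> grind

theorem signedFamily_zero_empty (L : List (V × E)) (z : V ⊕ E → ℂ) :
    signedFamily 0 L ∅ z = 1 := by
  induction L with
  | nil => exact detFamily_empty _ z
  | cons p L ih => rw [signedFamily_cons, edgeOp_of_notMem _ (by simp), ih]

/-- The averaged minors of the signings of a `(p² + 1, q² + 1)`-biregular bipartite graph are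
positive above `p + q`. -/
theorem signedFamily_zero_pos {L : List (V × E)} {p q x : ℝ} (hp : 0 < p) (hq : 0 < q)
    (hpq : 1 ≤ p * q) (hV : ∀ i, ((∑ e, L.count (i, e) : ℕ) : ℝ) = p ^ 2 + 1)
    (hE : ∀ e, ((∑ i, L.count (i, e) : ℕ) : ℝ) = q ^ 2 + 1) (hx : p + q < x)
    (S : Finset (V ⊕ E)) : 0 < (signedFamily 0 L S (fun _ => (x : ℂ))).re := by
  have hsumV : ∀ i, ∑ w, edgeMultiplicity L (Sum.inl i) w = ∑ e, L.count (i, e) := fun i => by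
    simp [Fintype.sum_sum_type, edgeMultiplicity]
  have hsumE : ∀ e, ∑ w, edgeMultiplicity L (Sum.inr e) w = ∑ i, L.count (i, e) := fun e => by
    simp [Fintype.sum_sum_type, edgeMultiplicity]
  refine matching_recursion_pos (N := edgeMultiplicity L) (x := x)
    (m := fun S => (signedFamily 0 L S (fun _ => (x : ℂ))).re)
    -- On a `V`-vertex the ratio is at least `x - p² / p > q` once an edge is lost, and
    -- symmetrically on `E`; with no edge lost, `x p > p² + 1` still holds because `p q ≥ 1`.
    (c := Sum.elim (fun _ => q) (fun _ => p)) (g := Sum.elim (fun _ => p) (fun _ => q))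
    ?_ ?_ ?_ ?_ ?_ ?_ ?_ ?_ S
  · rintro (i | i) (j | j) <;> rfl
  · rintro (i | i) <;> rfl
  · simp [signedFamily_zero_empty]
  · intro S u hu
    rw [isMatchingFamily_signedFamily_zero L S u hu]
    simp
  · rintro (i | i) <;> simpa
  · rintro (i | i) (j | j) <;> simp [edgeMultiplicity]
  · rintro (i | i)
    · rw [hsumV, hV]
      simp only [Sum.elim_inl]
      nlinarith
    · rw [hsumE, hE]
      simp only [Sum.elim_inr]
      nlinarith
  · rintro (i | i)
    · rw [hsumV, hV]
      simp only [Sum.elim_inl]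
      nlinarith
    · rw [hsumE, hE]
      simp only [Sum.elim_inr]
      nlinarith

end SignedFamily

/-! ### From bipartite matrices to spectra of 2-covers. -/

namespace Matrix

theorem det_fromBlocks_swap_symm {V R : Type*} [DecidableEq V] [Fintype V] [CommRing R]
    (P N : Matrix V V R) : (fromBlocks P N N P).det = (P + N).det * (P - N).det := by
  have h : fromBlocks 1 0 (-1) 1 * fromBlocks P N N P * fromBlocks 1 0 1 1
      = fromBlocks (P + N) N 0 (P - N) := by
    simp [fromBlocks_multiply]
    abel
  have h2 := congrArg det h
  rw [det_mul, det_mul, det_fromBlocks_zero₁₂, det_fromBlocks_zero₁₂, det_fromBlocks_zero₂₁] at h2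
  simpa using h2

theorem charpoly_fromBlocks_swap_symm {V R : Type*} [DecidableEq V] [Fintype V] [CommRing R]
    (P N : Matrix V V R) :
    (fromBlocks P N N P).charpoly = (P + N).charpoly * (P - N).charpoly := by
  have h : charmatrix (fromBlocks P N N P)
      = fromBlocks (charmatrix P) (-N.map Polynomial.C) (-N.map Polynomial.C) (charmatrix P) := by
    rw [charmatrix_fromBlocks]
  rw [charpoly, h, det_fromBlocks_swap_symm, charpoly, charpoly]
  congr 2
  · ext i j : 1
    simp [charmatrix_apply]
    ring
  · ext i j : 1
    simp [charmatrix_apply]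
    ring

end Matrix

/-- If `B Bᵀ` has the eigenvalue `y²` with `y > 0`, then the bipartite matrix of `B` has the
eigenvalue `y`. -/
theorem detFamily_bipartiteMatrix_eq_zero {V E : Type*} [DecidableEq V] [DecidableEq E] [Fintype V]
    [Fintype E] {B : Matrix V E ℝ} {y : ℝ} (hy : 0 < y) {w : V → ℝ} (hw : w ≠ 0)
    (h : (B * Bᵀ) *ᵥ w = y ^ 2 • w) :
    detFamily (bipartiteMatrix B) Finset.univ (fun _ => (y : ℂ)) = 0 := by
  have hmat : charMinor (bipartiteMatrix B) Finset.univ (fun _ => (y : ℂ))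
      = Complex.ofRealHom.mapMatrix (y • (1 : Matrix (V ⊕ E) (V ⊕ E) ℝ) - bipartiteMatrix B) := by
    ext i j
    simp [charMinor, diagonal_apply, one_apply]
    split_ifs <;> simp
  rw [detFamily, hmat, ← RingHom.map_det]
  suffices h0 : (y • (1 : Matrix (V ⊕ E) (V ⊕ E) ℝ) - bipartiteMatrix B).det = 0 by simp [h0]
  -- A left singular vector `w` for `y` completes to the eigenvector `(y w, Bᵀ w)`, nonzero since `y
  -- ≠ 0`.
  refine exists_mulVec_eq_zero_iff.1 ⟨Sum.elim (y • w) (Bᵀ *ᵥ w), ?_, ?_⟩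
  · intro h0
    refine hw (funext fun i => ?_)
    have := congrFun h0 (Sum.inl i)
    simpa [hy.ne'] using this
  · rw [sub_mulVec, smul_mulVec, one_mulVec, bipartiteMatrix, fromBlocks_mulVec]
    ext (i | e)
    · have := congrFun h i
      rw [Pi.smul_apply, smul_eq_mul] at this
      simp [this]
      ring
    · simp [mulVec_smul]

theorem natCard_fst_fiber {X : Type*} (x : X) : Nat.card {y : X × Bool // y.1 = x} = 2 := by
  rw [Nat.card_congr (β := Bool) ⟨fun y => y.1.2, fun b => ⟨(x, b), rfl⟩, ?_, ?_⟩]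
  · simp
  · rintro ⟨⟨y, b⟩, rfl⟩
    rfl
  · intro b
    rfl

/-! ### The 2-cover defined by signs on the incidences. -/

namespace MHypergraph

variable {V E : Type*} [DecidableEq V]

/-- The signed incidence matrix. -/
def signedIncidence (H : MHypergraph V E) (s : V × E → Bool) : Matrix V E ℝ :=
  Matrix.of fun i e => if i ∈ H.edge e then (if s (i, e) then -1 else 1) else 0

/-- The two-cover of a hypergraph given by signs on its incidences. -/
def signedCover (H : MHypergraph V E) (s : V × E → Bool) : MHypergraph (V × Bool) (E × Bool) where
  edge e := (H.edge e.1).image fun i => (i, xor (s (i, e.1)) e.2)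

theorem mem_signedCover_edge {H : MHypergraph V E} {s : V × E → Bool} {i : V × Bool} {e : E × Bool} :
    i ∈ (H.signedCover s).edge e ↔ i.1 ∈ H.edge e.1 ∧ i.2 = xor (s (i.1, e.1)) e.2 := by
  obtain ⟨i, a⟩ := i
  simp only [signedCover, Finset.mem_image, Prod.mk.injEq]
  constructor
  · rintro ⟨j, hj, rfl, rfl⟩
    exact ⟨hj, rfl⟩
  · rintro ⟨h1, h2⟩
    exact ⟨i, h1, rfl, h2.symm⟩

theorem isCover_signedCover (H : MHypergraph V E) (s : V × E → Bool) :
    IsCover 2 (H.signedCover s) H := by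
  refine ⟨Prod.fst, Prod.fst, ⟨Prod.fst_surjective, ?_, ?_⟩, natCard_fst_fiber, natCard_fst_fiber⟩
  · rintro ⟨e, c⟩
    refine ⟨fun i hi => (mem_signedCover_edge.1 hi).1, ?_, ?_⟩
    · rintro ⟨i, a⟩ hi ⟨j, b⟩ hj (rfl : i = j)
      have h1 := (mem_signedCover_edge.1 hi).2
      have h2 := (mem_signedCover_edge.1 hj).2
      simp_all
    · intro i hi
      exact ⟨(i, xor (s (i, e)) c), mem_signedCover_edge.2 ⟨hi, rfl⟩, rfl⟩
  · rintro ⟨i, a⟩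
    refine ⟨fun e he => (mem_signedCover_edge.1 he).1, ?_, ?_⟩
    · rintro ⟨e, c⟩ he ⟨f, c'⟩ hf (rfl : e = f)
      have h1 := (mem_signedCover_edge.1 he).2
      have h2 := (mem_signedCover_edge.1 hf).2
      simp_all
    · intro e he
      exact ⟨(e, xor (s (i, e)) a), mem_signedCover_edge.2 ⟨he, by simp⟩, rfl⟩

variable [Fintype E]

/-- The number of common edges of two distinct vertices for which the product of the signs is the
given one. -/
def signCount (H : MHypergraph V E) (s : V × E → Bool) (b : Bool) : Matrix V V ℝ :=
  Matrix.of fun i j => if i = j then 0 else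
    ∑ e, if (i ∈ H.edge e ∧ j ∈ H.edge e) ∧ xor (s (i, e)) (s (j, e)) = b then 1 else 0

/-- Lifts of `i` and `j` share exactly one lift of a common edge if their sheets differ by the
product of the two signs, and none otherwise. -/
theorem adjMatrix_signedCover (H : MHypergraph V E) (s : V × E → Bool) (i j : V × Bool) :
    (H.signedCover s).adjMatrix i j = H.signCount s (xor i.2 j.2) i.1 j.1 := by
  obtain ⟨i, a⟩ := i
  obtain ⟨j, b⟩ := j
  simp only [adjMatrix, signCount, Matrix.of_apply, Finset.card_filter, Nat.cast_sum,
    Fintype.sum_prod_type, mem_signedCover_edge, Fintype.sum_bool]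
  rcases eq_or_ne i j with rfl | hij
  · rw [if_pos rfl]
    rcases eq_or_ne a b with rfl | hab
    · simp
    · rw [if_neg (by simpa using hab)]
      refine Finset.sum_eq_zero fun e _ => ?_
      rw [if_neg, if_neg]
      · ring
      · rintro ⟨⟨_, h1⟩, _, h2⟩
        exact hab (h1.trans h2.symm)
      · rintro ⟨⟨_, h1⟩, _, h2⟩
        exact hab (h1.trans h2.symm)
  · rw [if_neg (by simp [hij]), if_neg hij]
    refine Finset.sum_congr rfl fun e _ => ?_
    by_cases h1 : i ∈ H.edge e <;> by_cases h2 : j ∈ H.edge e <;> simp only [h1, h2] <;>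
    cases s (i, e) <;> cases s (j, e) <;> cases a <;> cases b <;> simp

theorem signCount_false_add_signCount_true (H : MHypergraph V E) (s : V × E → Bool) :
    H.signCount s false + H.signCount s true = H.adjMatrix := by
  ext i j
  simp only [signCount, adjMatrix, Matrix.add_apply, Matrix.of_apply, Finset.card_filter,
    Nat.cast_sum]
  split_ifs
  · simp
  · rw [← Finset.sum_add_distrib]
    refine Finset.sum_congr rfl fun e _ => ?_
    by_cases h : i ∈ H.edge e ∧ j ∈ H.edge e <;> cases s (i, e) <;> cases s (j, e) <;> simp [h]

theorem signCount_false_sub_signCount_true {H : MHypergraph V E} {d : ℕ}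
    (hd : ∀ i, H.degree i = d) (s : V × E → Bool) :
    H.signCount s false - H.signCount s true =
      H.signedIncidence s * (H.signedIncidence s)ᵀ - (d : ℝ) • 1 := by
  ext i j
  simp only [signCount, signedIncidence, Matrix.sub_apply, Matrix.of_apply, Matrix.mul_apply,
    Matrix.transpose_apply, Matrix.smul_apply, smul_eq_mul]
  rcases eq_or_ne i j with rfl | hij
  · have h : ∑ e, (if i ∈ H.edge e then (if s (i, e) then (-1 : ℝ) else 1) else 0) *
        (if i ∈ H.edge e then (if s (i, e) then -1 else 1) else 0) = d := by
      rw [← hd i, degree, Finset.card_filter, Nat.cast_sum]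
      refine Finset.sum_congr rfl fun e _ => ?_
      by_cases h : i ∈ H.edge e <;> cases s (i, e) <;> simp [h]
    rw [h]
    simp
  · rw [if_neg hij, if_neg hij, Matrix.one_apply_ne hij, mul_zero, sub_zero,
      ← Finset.sum_sub_distrib]
    refine Finset.sum_congr rfl fun e _ => ?_
    by_cases h1 : i ∈ H.edge e <;> by_cases h2 : j ∈ H.edge e <;>
    cases s (i, e) <;> cases s (j, e) <;> simp [h1, h2]

variable [Fintype V]

theorem eigenvalues_signedCover {H : MHypergraph V E} {d : ℕ} (hd : ∀ i, H.degree i = d)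
    (s : V × E → Bool) :
    (H.signedCover s).eigenvalues = H.eigenvalues +
      (H.signedIncidence s * (H.signedIncidence s)ᵀ - (d : ℝ) • 1).charpoly.roots := by
  set e : V × Bool ≃ V ⊕ V := (Equiv.prodComm V Bool).trans (Equiv.boolProdEquivSum V) with he
  have h1 : Matrix.reindex e e (H.signedCover s).adjMatrix = Matrix.fromBlocks
      (H.signCount s false) (H.signCount s true) (H.signCount s true) (H.signCount s false) := by
    ext (i | i) (j | j) <;> simp [he, adjMatrix_signedCover]
  rw [eigenvalues, ← Matrix.charpoly_reindex e, h1, Matrix.charpoly_fromBlocks_swap_symm,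
    Polynomial.roots_mul, signCount_false_add_signCount_true, signCount_false_sub_signCount_true hd,
    eigenvalues]
  exact ((Matrix.charpoly_monic _).mul (Matrix.charpoly_monic _)).ne_zero

/-- Some signed incidence matrix of a `(d, r)`-regular hypergraph has no singular value above
`√(d - 1) + √(r - 1)`. -/
theorem exists_signs_detFamily_ne_zero [DecidableEq E] {H : MHypergraph V E} {d r : ℕ} (hd : 2 ≤ d)
    (hreg : H.IsRegular d r) :
    ∃ s : V × E → Bool, ∀ y : ℝ, √((d : ℝ) - 1) + √((r : ℝ) - 1) < y →
      detFamily (bipartiteMatrix (H.signedIncidence s)) Finset.univ (fun _ => (y : ℂ)) ≠ 0 := by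
  obtain ⟨hdeg, hr, huni⟩ := hreg
  have hd' : (1 : ℝ) ≤ (d : ℝ) - 1 := by
    have : (2 : ℝ) ≤ d := by exact_mod_cast hd
    linarith
  have hr' : (1 : ℝ) ≤ (r : ℝ) - 1 := by
    have : (2 : ℝ) ≤ r := by exact_mod_cast hr
    linarith
  have hp := Real.one_le_sqrt.2 hd'
  have hq := Real.one_le_sqrt.2 hr'
  by_contra! hcon
  choose y hy hzero using hcon
  -- The choice of signs depends on the point `x`. Taking `x` to be the least of the bad zeros
  -- ensures that the zero belonging to the chosen signs lies at or above `x`, where positivity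
  -- persists.
  obtain ⟨s₀, hs₀⟩ := Finite.exists_min y
  set L : List (V × E) := (Finset.univ.filter fun p : V × E => p.1 ∈ H.edge p.2).toList with hL
  have hnodup : L.Nodup := Finset.nodup_toList _
  have hmem : ∀ i e, (i, e) ∈ L ↔ i ∈ H.edge e := by simp [hL]
  have hcount : ∀ i e, L.count (i, e) = if i ∈ H.edge e then 1 else 0 := by
    intro i e
    rw [hnodup.count]
    simp only [hmem]
  obtain ⟨B, h1, h2, h3⟩ := exists_signs_pos L hnodup 0 (y s₀)
    (signedFamily_zero_pos (by linarith) (by linarith) (by nlinarith) (fun i => by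
      rw [Real.sq_sqrt (by linarith), ← hdeg i, degree, Finset.card_filter]
      simp [hcount]) (fun e => by
      rw [Real.sq_sqrt (by linarith), ← huni e]
      simp [hcount]) (hy s₀))
  have hB : B = H.signedIncidence (fun p => decide (B p.1 p.2 = -1)) := by
    ext i e
    simp only [signedIncidence, Matrix.of_apply]
    by_cases hie : i ∈ H.edge e
    · rcases h2 i e ((hmem i e).2 hie) with h | h <;> simp at h <;> simp [hie, h]
    · simpa [hie] using h1 i e fun h => hie ((hmem i e).1 h)
  rw [hB] at h3
  have h4 := (isStableFamily_detFamily (isSymm_bipartiteMatrix _)).re_pos_of_le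
    (hs₀ (fun p => decide (B p.1 p.2 = -1))) h3 Finset.univ
  rw [hzero] at h4
  simp at h4

end MHypergraph

theorem theorem1p3 {V : Type u} {E : Type v} [Fintype V] [DecidableEq V] [Fintype E]
    (H : MHypergraph V E) (d r : ℕ) (hd : 2 ≤ d) (hreg : H.IsRegular d r) (hconn : H.Connected) :
    ∃ (V' : Type u) (E' : Type v) (_ : Fintype V') (_ : DecidableEq V') (_ : Fintype E')
      (H' : MHypergraph V' E'), H'.IsRightSidedRamanujanCover H d r := by
  classical
  obtain ⟨s, hs⟩ := MHypergraph.exists_signs_detFamily_ne_zero hd hreg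
  have heig := MHypergraph.eigenvalues_signedCover hreg.1 s
  set C := H.signedIncidence s * (H.signedIncidence s)ᵀ - (d : ℝ) • 1 with hC
  have hnew : (H.signedCover s).newEigenvalues H = C.charpoly.roots := by
    rw [MHypergraph.newEigenvalues, heig, add_tsub_cancel_left]
  refine ⟨V × Bool, E × Bool, inferInstance, inferInstance, inferInstance, H.signedCover s,
    H.isCover_signedCover s, by rw [hnew, heig], ?_⟩
  rw [hnew]
  intro x hx
  by_contra! hlt
  have hd' : (0 : ℝ) ≤ (d : ℝ) - 1 := by
    have : (2 : ℝ) ≤ d := by exact_mod_cast hd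
    linarith
  have hr' : (0 : ℝ) ≤ (r : ℝ) - 1 := by
    have : (2 : ℝ) ≤ r := by exact_mod_cast hreg.2.1
    linarith
  have hsq : (√((d : ℝ) - 1) + √((r : ℝ) - 1)) ^ 2 < x + d := by
    rw [add_sq, Real.sq_sqrt hd', Real.sq_sqrt hr', mul_assoc, ← Real.sqrt_mul hd']
    linarith
  have hpos : 0 < x + d := (sq_nonneg _).trans_lt hsq
  -- An eigenvalue `x` of `B Bᵀ - d` gives the singular value `√(x + d)` of `B`.
  refine hs (√(x + d)) ((Real.lt_sqrt (by positivity)).2 hsq) ?_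
  have hroot := (Polynomial.mem_roots'.1 hx).2
  rw [Polynomial.IsRoot, Matrix.eval_charpoly] at hroot
  obtain ⟨w, hw, hw0⟩ := exists_mulVec_eq_zero_iff.2 hroot
  refine detFamily_bipartiteMatrix_eq_zero (Real.sqrt_pos.2 hpos) hw ?_
  rw [hC, sub_mulVec, sub_mulVec, smul_mulVec, one_mulVec] at hw0
  ext i
  have := congrFun hw0 i
  simp only [scalar_apply, Pi.sub_apply, mulVec_diagonal, Pi.smul_apply, smul_eq_mul,
    Pi.zero_apply] at this
  rw [Pi.smul_apply, smul_eq_mul, Real.sq_sqrt hpos.le]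
  linarith
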